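/- Let $N\ge 1$ be an integer and define the rational function $$\psi_N(c) := 1-\sum_{i=0}^{N-1}\frac{(c-1)(2Nc+1)(2Nc-2N+1)}{(4i+2)Nc-2i^2+1}.$$ Then $\psi_N$ has a largest real root $c_{\mathrm{crit}}$ (a root being a real $c$ at which no denominator vanishes and $\psi_N(c)=0$), and $c_{\mathrm{crit}}>1$. Moreover, for every $L>0$, every stepsize $h\in(0,1]$ and every $c\in[1,c_{\mathrm{crit}}]$ the following hold. (i) Let $m\ge 0$, let $f:\mathbb{R}^m\to\mathbb{R}$ be convex and $L$-smooth (differentiable with $L$-Lipschitz gradient for the Euclidean norm) with a minimizer $x_\star$, and let $x_0\in\mathbb{R}^m$, $D=\|x_0-x_\star\|$. If $x_{k+1}=x_k-\frac{h}{L}\nabla f(x_k)$ for $k=0,\dots,N-1$, then $x_\sigma:=x_0+c(x_N-x_0)$ satisfies $$f(x_\sigma)-f(x_\star)\le\frac{LD^2}{4Nhc+2}.$$ (ii) For every $D>0$ equality is attained in (i) in dimension one by a Huber function: there are $\eta>0$ and $x_0,x_\star\in\mathbb{R}$ with $|x_0-x_\star|=D$ such that $$\phi_{L,\eta}(x)=\begin{cases}\frac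 L2x^2,&|x|\le\eta,\\ L\eta|x|-\frac{L\eta^2}{2},&|x|>\eta,\end{cases}$$ is convex and $L$-smooth with minimizer $x_\star$, and $x_\sigma=x_0+c(x_N-x_0)$, formed from gradient descent on $f=\phi_{L,\eta}$ with stepsize $h$ started at $x_0$, satisfies $f(x_\sigma)-f(x_\star)=\frac{LD^2}{4Nhc+2}$. -/

import Mathlib

open scoped Gradient

/-- `f` is differentiable and its gradient is `L`-Lipschitz. -/
def IsLSmooth {m : ℕ} (L : ℝ) (f : EuclideanSpace ℝ (Fin m) → ℝ) : Prop :=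
  Differentiable ℝ f ∧ ∀ x y, ‖∇ f x - ∇ f y‖ ≤ L * ‖x - y‖

/-- The gradient descent iterates `x_{k+1} = x_k - (h / L) ∇ f(x_k)` started at `x₀`. -/
noncomputable def gdIterate {m : ℕ} (f : EuclideanSpace ℝ (Fin m) → ℝ) (L h : ℝ)
    (x₀ : EuclideanSpace ℝ (Fin m)) : ℕ → EuclideanSpace ℝ (Fin m)
  | 0 => x₀
  | k + 1 => gdIterate f L h x₀ k - (h / L) • ∇ f (gdIterate f L h x₀ k)

/-- The simple extrapolation `x₀ + c (x_N - x₀)` of gradient descent after `N` steps. -/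
noncomputable def simpleExtrapolation {m : ℕ} (f : EuclideanSpace ℝ (Fin m) → ℝ) (L h : ℝ)
    (x₀ : EuclideanSpace ℝ (Fin m)) (N : ℕ) (c : ℝ) : EuclideanSpace ℝ (Fin m) :=
  x₀ + c • (gdIterate f L h x₀ N - x₀)

/-- The common numerator of the summands of `ψ_N`. -/
def psiNum (N : ℕ) (c : ℝ) : ℝ :=
  (c - 1) * (2 * N * c + 1) * (2 * N * c - 2 * N + 1)

/-- The denominator of the `i`-th summand of `ψ_N`. -/
def psiDenom (N i : ℕ) (c : ℝ) : ℝ :=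
  (4 * i + 2) * N * c - 2 * (i : ℝ) ^ 2 + 1

/-- The rational function `ψ_N`. -/
noncomputable def psi (N : ℕ) (c : ℝ) : ℝ :=
  1 - ∑ i ∈ Finset.range N, psiNum N c / psiDenom N i c

/-- The real roots of `ψ_N`: points where no denominator vanishes and `ψ_N(c) = 0`. -/
def psiRoots (N : ℕ) : Set ℝ :=
  {c | (∀ i < N, psiDenom N i c ≠ 0) ∧ psi N c = 0}

/-- The one-dimensional Huber function `φ_{L,η}`. -/
noncomputable def huber (L η : ℝ) (x : ℝ) : ℝ :=
  if |x| ≤ η then L / 2 * x ^ 2 else L * η * |x| - L * η ^ 2 / 2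

/-! The bound is a weighted sum of interpolation inequalities: between consecutive points of x_0, …,
x_{N-1}, x_σ (x_N itself is not needed), and between x_⋆ and each of them. With T = 2Nc+1 and λ_i =
i/(T-i), the weights are cλ_1, …, cλ_N along the chain and c(λ_{i+1}-λ_i), 1-cλ_N at x_⋆, so the
function values telescope. Let W be the mean of the gradients, divided by L, with the weights at
x_⋆. Once nonnegative multiples of 1-h are dropped, the quadratic part is affine in h: its h = 1
part is at least T‖W‖² (`mul_norm_sq_le_gradForm`), its h = 0 part at least ‖W‖²
(`norm_sq_le_of_weights`). As hT+(1-h) = 2Nhc+1, completing the square against x_0-x_⋆ gives the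
rate.

ψ_N enters at h = 1. Subtracting the gradient at x_σ from the others leaves cT‖w‖² ≤ `gradForm T N
u` with w = ∑ t_i u_i, t_i = λ_{i+1}-λ_i. Elimination writes `gradForm` - T‖w‖² as a positive sum of
squares, Cauchy–Schwarz bounds ‖w‖² by K times that sum, and (c-1)TK = 1-ψ_N(c)/(T-2N) ≤ 1 as soon
as ψ_N(c) ≥ 0. This holds up to c_crit because ψ_N decreases strictly on [1,∞).

Equality holds for a Huber function whose linear branch contains all the points. -/

/-! ### Monotonicity and roots of ψ_N -/

lemma psiDenom_one_pos {N i : ℕ} (hi : i < N) : 0 < psiDenom N i 1 := by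
  have h : (i : ℝ) + 1 ≤ N := by exact_mod_cast hi
  have h0 : (0 : ℝ) ≤ i := i.cast_nonneg
  unfold psiDenom
  nlinarith

lemma psiDenom_eq (N i : ℕ) (c : ℝ) :
    psiDenom N i c = (4 * i + 2) * N * (c - 1) + psiDenom N i 1 := by
  unfold psiDenom; ring

lemma psiDenom_pos {N i : ℕ} (hi : i < N) {c : ℝ} (hc : 1 ≤ c) : 0 < psiDenom N i c := by
  rw [psiDenom_eq]
  have := psiDenom_one_pos hi
  have : 0 ≤ (4 * i + 2) * N * (c - 1) := mul_nonneg (by positivity) (by linarith)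
  linarith

/-- The denominator is affine in c and positive at 1, so (c-1)/denominator increases strictly; the
other two factors of the numerator are positive and increasing. -/
lemma psiNum_div_psiDenom_lt {N i : ℕ} (hi : i < N) {a b : ℝ} (ha : 1 ≤ a) (hab : a < b) :
    psiNum N a / psiDenom N i a < psiNum N b / psiDenom N i b := by
  have hN : (0 : ℝ) < N := by exact_mod_cast (Nat.zero_le i).trans_lt hi
  have hda := psiDenom_pos hi ha
  have hdb := psiDenom_pos hi (ha.trans hab.le)
  have h1 : (a - 1) / psiDenom N i a < (b - 1) / psiDenom N i b := by
    rw [div_lt_div_iff₀ hda hdb, psiDenom_eq N i a, psiDenom_eq N i b]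
    nlinarith [mul_pos (sub_pos.2 hab) (psiDenom_one_pos hi)]
  have key : ∀ c : ℝ, psiNum N c / psiDenom N i c =
      (c - 1) / psiDenom N i c * ((2 * N * c + 1) * (2 * N * (c - 1) + 1)) := by
    intro c; unfold psiNum; ring
  have h2 : (2 * N * a + 1) * (2 * N * (a - 1) + 1) ≤ (2 * N * b + 1) * (2 * N * (b - 1) + 1) := by
    have : 0 ≤ a - 1 := by linarith
    have : 0 ≤ b - 1 := by linarith
    have : 0 ≤ 2 * N * b + 1 := by nlinarith
    gcongr
  have h3 : 0 < (2 * N * b + 1) * (2 * N * (b - 1) + 1) := by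
    have : 0 ≤ b - 1 := by linarith
    have : 0 < b := by linarith
    positivity
  rw [key, key]
  have h4 : 0 ≤ (a - 1) / psiDenom N i a := div_nonneg (by linarith) hda.le
  calc _ ≤ (a - 1) / psiDenom N i a * ((2 * N * b + 1) * (2 * N * (b - 1) + 1)) := by gcongr
    _ < _ := by gcongr

lemma psi_strictAntiOn {N : ℕ} (hN : 0 < N) : StrictAntiOn (psi N) (Set.Ici 1) := by
  intro a ha b _ hab
  unfold psi
  have := Finset.sum_lt_sum_of_nonempty (Finset.nonempty_range_iff.2 hN.ne')
    fun i hi => psiNum_div_psiDenom_lt (Finset.mem_range.1 hi) ha hab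
  linarith

lemma psi_one (N : ℕ) : psi N 1 = 1 := by
  simp [psi, psiNum]

/-- The summand i = 0 alone equals 2N+1 at c = 2. -/
lemma psi_two_neg {N : ℕ} (hN : 0 < N) : psi N 2 < 0 := by
  have hN' : (0 : ℝ) < N := by exact_mod_cast hN
  have h : psiNum N 2 / psiDenom N 0 2 ≤
      ∑ i ∈ Finset.range N, psiNum N 2 / psiDenom N i 2 := by
    refine Finset.single_le_sum (f := fun i => psiNum N 2 / psiDenom N i 2)
      (fun i hi => div_nonneg ?_ (psiDenom_pos (Finset.mem_range.1 hi) one_le_two).le)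
      (Finset.mem_range.2 hN)
    unfold psiNum
    have : (0 : ℝ) ≤ 2 * N * 2 - 2 * N + 1 := by linarith
    positivity
  have h' : 1 < psiNum N 2 / psiDenom N 0 2 := by
    rw [one_lt_div (psiDenom_pos hN one_le_two)]
    unfold psiNum psiDenom
    push_cast
    nlinarith
  unfold psi
  linarith

lemma continuousOn_psi (N : ℕ) : ContinuousOn (psi N) (Set.Ici 1) := by
  unfold psi
  refine continuousOn_const.sub (continuousOn_finsetSum _ fun i hi => ContinuousOn.div ?_ ?_
    fun c hc => (psiDenom_pos (Finset.mem_range.1 hi) hc).ne')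
  · unfold psiNum; fun_prop
  · unfold psiDenom; fun_prop

/-- `ψ_N` has a largest root; it exceeds `1`, and `ψ_N` is nonnegative between `1` and it. -/
lemma exists_isGreatest_psiRoots {N : ℕ} (hN : 0 < N) :
    ∃ c₀ : ℝ, IsGreatest (psiRoots N) c₀ ∧ 1 < c₀ ∧ ∀ c ∈ Set.Icc 1 c₀, 0 ≤ psi N c := by
  obtain ⟨c₀, hc₀, h0⟩ : (0 : ℝ) ∈ psi N '' Set.Icc 1 2 :=
    intermediate_value_Icc' one_le_two ((continuousOn_psi N).mono Set.Icc_subset_Ici_self)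
      ⟨(psi_two_neg hN).le, by simp [psi_one]⟩
  refine ⟨c₀, ⟨⟨fun i hi => (psiDenom_pos hi hc₀.1).ne', h0⟩, fun c hc => ?_⟩, ?_, fun c hc => ?_⟩
  · by_contra! hlt
    have := psi_strictAntiOn hN hc₀.1 (hc₀.1.trans hlt.le) hlt
    linarith [hc.2]
  · refine lt_of_le_of_ne hc₀.1 ?_
    rintro rfl
    simp [psi_one] at h0
  · rw [← h0]
    exact (psi_strictAntiOn hN).antitoneOn hc.1 hc₀.1 hc.2

/-! ### Inequalities for smooth convex functions -/

section Smooth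
variable {m : ℕ} {f : EuclideanSpace ℝ (Fin m) → ℝ} {L : ℝ}

lemma hasDerivAt_comp_line (hf : Differentiable ℝ f) (x d : EuclideanSpace ℝ (Fin m)) (t : ℝ) :
    HasDerivAt (fun s : ℝ => f (x + s • d)) (inner ℝ (∇ f (x + t • d)) d) t := by
  have h1 : HasDerivAt (fun s : ℝ => x + s • d) d t := by
    simpa using ((hasDerivAt_id t).smul_const d).const_add x
  have h2 := (hf (x + t • d)).hasFDerivAt.comp_hasDerivAt t h1
  rwa [← inner_gradient_left] at h2

lemma ConvexOn.add_inner_gradient_le (hc : ConvexOn ℝ Set.univ f) (hf : Differentiable ℝ f)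
    (x y : EuclideanSpace ℝ (Fin m)) : f x + inner ℝ (∇ f x) (y - x) ≤ f y := by
  have hg : ConvexOn ℝ Set.univ (fun s : ℝ => f (x + s • (y - x))) := by
    have := hc.comp_affineMap (AffineMap.lineMap x y : ℝ →ᵃ[ℝ] EuclideanSpace ℝ (Fin m))
    simpa [Function.comp_def, AffineMap.lineMap_apply, add_comm] using this
  have := hg.le_slope_of_hasDerivAt (Set.mem_univ 0) (Set.mem_univ 1) one_pos
    (hasDerivAt_comp_line hf x (y - x) 0)
  simp only [slope_def_field, zero_smul, one_smul, add_zero, add_sub_cancel, sub_zero,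
    div_one] at this
  linarith

/-- The descent lemma. -/
lemma IsLSmooth.le_add_inner_gradient (hf : IsLSmooth L f) (x d : EuclideanSpace ℝ (Fin m)) :
    f (x + d) ≤ f x + inner ℝ (∇ f x) d + L / 2 * ‖d‖ ^ 2 := by
  have hB : ∀ t : ℝ, HasDerivAt (fun s : ℝ => f x + s * inner ℝ (∇ f x) d + L / 2 * ‖d‖ ^ 2 * s ^ 2)
      (inner ℝ (∇ f x) d + L * ‖d‖ ^ 2 * t) t := by
    intro t
    have := (((hasDerivAt_id t).mul_const (inner ℝ (∇ f x) d)).const_add (f x)).add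
      (((hasDerivAt_id t).pow 2).const_mul (L / 2 * ‖d‖ ^ 2))
    refine this.congr_deriv ?_
    simp; ring
  have h := image_le_of_deriv_right_le_deriv_boundary (a := 0) (b := 1)
    (fun t _ => (hasDerivAt_comp_line hf.1 x d t).continuousAt.continuousWithinAt)
    (fun t _ => (hasDerivAt_comp_line hf.1 x d t).hasDerivWithinAt) (by simp)
    (fun t _ => (hB t).continuousAt.continuousWithinAt)
    (fun t _ => (hB t).hasDerivWithinAt) (fun t ht => ?_)
    (Set.right_mem_Icc.2 zero_le_one)
  · simpa using h
  · have h1 : inner ℝ (∇ f (x + t • d) - ∇ f x) d ≤ L * ‖t • d‖ * ‖d‖ := by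
      refine (real_inner_le_norm _ _).trans ?_
      gcongr
      simpa using hf.2 (x + t • d) x
    rw [inner_sub_left, norm_smul, Real.norm_of_nonneg ht.1] at h1
    nlinarith

/-- The interpolation inequality of smooth convex functions. -/
lemma ConvexOn.add_inner_gradient_add_le (hc : ConvexOn ℝ Set.univ f) (hL : 0 < L)
    (hf : IsLSmooth L f) (x y : EuclideanSpace ℝ (Fin m)) :
    f y + inner ℝ (∇ f y) (x - y) + 1 / (2 * L) * ‖∇ f x - ∇ f y‖ ^ 2 ≤ f x := by
  set e := ∇ f x - ∇ f y with he
  -- The step -e/L minimizes the descent bound at x for f minus its linear part at y; convexity at y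
  -- bounds the same point from below.
  have h1 := hf.le_add_inner_gradient x (-(1 / L) • e)
  have h2 := hc.add_inner_gradient_le hf.1 y (x + -(1 / L) • e)
  have h3 : inner ℝ (∇ f x) e - inner ℝ (∇ f y) e = ‖e‖ ^ 2 := by
    rw [← inner_sub_left, ← he, real_inner_self_eq_norm_sq]
  have h4 : L / 2 * (1 / L * ‖e‖) ^ 2 = 1 / (2 * L) * ‖e‖ ^ 2 := by field_simp
  have h5 : x + -(1 / L) • e - y = (x - y) + -(1 / L) • e := by abel
  rw [norm_smul, norm_neg, Real.norm_of_nonneg (by positivity), h4, inner_smul_right] at h1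
  rw [h5, inner_add_right, inner_smul_right] at h2
  have h6 : 1 / L * ‖e‖ ^ 2 = 2 * (1 / (2 * L) * ‖e‖ ^ 2) := by field_simp
  rw [← h3] at h6
  rw [← h3] at h1 ⊢
  linarith

lemma gradient_eq_zero_of_forall_le {x : EuclideanSpace ℝ (Fin m)} (hx : ∀ y, f x ≤ f y) :
    ∇ f x = 0 := by
  have : IsLocalMin f x := Filter.Eventually.of_forall hx
  simp [gradient, this.fderiv_eq_zero]

end Smooth

/-! ### Multipliers and their algebraic identities -/

/-- The multiplier of the interpolation inequality between consecutive iterates, up to a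
factor `c`. -/
noncomputable def chainWeight (T : ℝ) (i : ℕ) : ℝ := i / (T - i)

/-- The multiplier of the interpolation inequality between the minimizer and the `i`-th iterate,
up to a factor `c`. -/
noncomputable def starWeight (T : ℝ) (i : ℕ) : ℝ := chainWeight T (i + 1) - chainWeight T i

/-- The coefficients of the rank one corrections in the elimination of the variables of
`gradForm`. -/
noncomputable def corrCoeff (T : ℝ) (i : ℕ) : ℝ := (T - i) ^ 2 / (T - 2 * i)

/-- The pivots in the elimination of the variables of `gradForm`. -/
noncomputable def pivot (T : ℝ) (i : ℕ) : ℝ :=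
  (T - 2 * i - 2) * ((2 * i + 1) * T - 2 * i * (i + 1)) / ((T - 2 * i) * (T - i - 1) ^ 2)

section Weights
variable {T : ℝ} {i : ℕ}

lemma starWeight_eq (hi : 2 * (i : ℝ) + 2 < T) :
    starWeight T i = T / ((T - i) * (T - i - 1)) := by
  have h0 : (0 : ℝ) ≤ i := i.cast_nonneg
  have h1 : T - i ≠ 0 := by linarith
  have h2 : T - (i + 1) ≠ 0 := by linarith
  have h3 : T - i - 1 ≠ 0 := by linarith
  unfold starWeight chainWeight
  push_cast
  field_simp
  ring

lemma starWeight_nonneg (hi : 2 * (i : ℝ) + 2 < T) : 0 ≤ starWeight T i := by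
  have h0 : (0 : ℝ) ≤ i := i.cast_nonneg
  have h1 : 0 < T - i := by linarith
  have h3 : 0 < T - i - 1 := by linarith
  rw [starWeight_eq hi]
  have : 0 ≤ T := by linarith
  positivity

lemma chainWeight_nonneg (hi : (i : ℝ) ≤ T) : 0 ≤ chainWeight T i :=
  div_nonneg i.cast_nonneg (by linarith)

/-- This recurrence, (T-i-1)λ_{i+1} = (T-i)λ_i + 1 with λ_0 = 0, forces the choice of λ_i. It
matches the coefficients of ⟨u_i, G⟩ in `gradForm_translate`. -/
lemma chainWeight_succ_add (hi : 2 * (i : ℝ) + 2 < T) :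
    chainWeight T (i + 1) + i * starWeight T i + 1 = T * starWeight T i := by
  have h0 : (0 : ℝ) ≤ i := i.cast_nonneg
  have h1 : T - i ≠ 0 := by linarith
  have h2 : T - (i + 1) ≠ 0 := by linarith
  unfold starWeight chainWeight
  push_cast
  field_simp
  ring

lemma pivot_den_pos (hi : 2 * (i : ℝ) + 2 < T) : 0 < (2 * i + 1) * T - 2 * i * (i + 1) := by
  have h0 : (0 : ℝ) ≤ i := i.cast_nonneg
  nlinarith

lemma pivot_pos (hi : 2 * (i : ℝ) + 2 < T) : 0 < pivot T i := by
  have h0 : (0 : ℝ) ≤ i := i.cast_nonneg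
  have h1 : 0 < T - 2 * i - 2 := by linarith
  have h2 : 0 < T - 2 * i := by linarith
  have h3 : 0 < T - i - 1 := by linarith
  have := pivot_den_pos hi
  unfold pivot
  positivity

lemma pivot_eq (hi : 2 * (i : ℝ) + 2 < T) :
    2 * chainWeight T (i + 1) - corrCoeff T i * starWeight T i ^ 2 = pivot T i := by
  have h0 : (0 : ℝ) ≤ i := i.cast_nonneg
  have h1 : T - i ≠ 0 := by linarith
  have h2 : T - i * 2 ≠ 0 := by linarith
  have h2' : T - 2 * i ≠ 0 := by linarith
  have h3 : T - i - 1 ≠ 0 := by linarith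
  rw [starWeight_eq hi]
  unfold chainWeight corrCoeff pivot
  push_cast
  rw [← sub_sub]
  field_simp
  ring

/-- Completing the square in `u i` leaves a multiple of the squared tail, which is absorbed into the
next correction. -/
lemma corrCoeff_succ_sub (hi : 2 * (i : ℝ) + 2 < T) :
    (corrCoeff T (i + 1) - corrCoeff T i) * pivot T i =
      (1 - corrCoeff T i * starWeight T i) ^ 2 := by
  have h0 : (0 : ℝ) ≤ i := i.cast_nonneg
  have h1 : T - i ≠ 0 := by linarith
  have h2 : T - i * 2 ≠ 0 := by linarith
  have h2' : T - 2 * i ≠ 0 := by linarith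
  have h3 : T - i - 1 ≠ 0 := by linarith
  have h4 : T - 2 * (i + 1) ≠ 0 := by linarith
  obtain ⟨e, he⟩ : ∃ e, e = T - 2 * i - 2 := ⟨_, rfl⟩
  have h5 : e ≠ 0 := by rw [he]; linarith
  rw [starWeight_eq hi]
  unfold corrCoeff pivot
  push_cast
  rw [show T - 2 * ((i : ℝ) + 1) = T - 2 * i - 2 by ring, ← he]
  field_simp
  rw [he]
  ring

/-- Gives the coefficient left on the tail when `u i` is expressed by `elimVar`: a ratio of
consecutive values of (T-i)/(T-2i). -/
lemma one_sub_starWeight_mul (hi : 2 * (i : ℝ) + 2 < T) :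
    pivot T i - starWeight T i * (1 - corrCoeff T i * starWeight T i) =
      (T - 2 * i) * (T - i - 1) / ((T - 2 * i - 2) * (T - i)) * pivot T i := by
  have h0 : (0 : ℝ) ≤ i := i.cast_nonneg
  have h1 : T - i ≠ 0 := by linarith
  have h2 : T - i * 2 ≠ 0 := by linarith
  have h2' : T - 2 * i ≠ 0 := by linarith
  have h3 : T - i - 1 ≠ 0 := by linarith
  have h4 : T - 2 * i - 2 ≠ 0 := by linarith
  rw [starWeight_eq hi]
  unfold corrCoeff pivot
  field_simp
  ring

/-- A term of the Cauchy–Schwarz constant: the reciprocal of a denominator of ψ_N when T = 2Nc+1,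
plus a telescoping difference. -/
lemma starWeight_sq_div_pivot (hi : 2 * (i : ℝ) + 2 < T) :
    ((T - i) / (T - 2 * i) * starWeight T i) ^ 2 / pivot T i =
      1 / ((2 * i + 1) * T - 2 * i * (i + 1)) + (1 / (T - 2 * (i + 1)) - 1 / (T - 2 * i)) := by
  have h0 : (0 : ℝ) ≤ i := i.cast_nonneg
  have h1 : T - i ≠ 0 := by linarith
  have h2 : T - i * 2 ≠ 0 := by linarith
  have h2' : T - 2 * i ≠ 0 := by linarith
  have h3 : T - i - 1 ≠ 0 := by linarith
  have h4 : T - 2 * (i + 1) ≠ 0 := by linarith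
  have h4' : T - 2 * i - 2 ≠ 0 := by linarith
  have h5 := (pivot_den_pos hi).ne'
  have h6 : T - 2 * i - 2 = T - 2 * (i + 1) := by ring
  rw [starWeight_eq hi]
  unfold pivot
  rw [h6]
  obtain ⟨D, hD⟩ : ∃ D, D = (2 * i + 1) * T - 2 * i * (i + 1) := ⟨_, rfl⟩
  rw [← hD] at h5 ⊢
  field_simp
  rw [hD]
  ring

end Weights

/-! ### Diagonalization of the gradient form -/

section Form
variable {E : Type*} [NormedAddCommGroup E] [InnerProductSpace ℝ E]

open Finset

/-- The quadratic form of the gradients produced by the weighted interpolation inequalities. -/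
noncomputable def gradForm (T : ℝ) (n : ℕ) (u : ℕ → E) : ℝ :=
  ∑ i ∈ range n, (2 * chainWeight T (i + 1) * ‖u i‖ ^ 2 +
    2 * starWeight T i * inner ℝ (u i) (∑ j ∈ range i, u j))

/-- The part of the weighted sum of the gradients that comes after the first `i` terms. -/
noncomputable def tailSum (T : ℝ) (n : ℕ) (u : ℕ → E) (i : ℕ) : E :=
  ∑ j ∈ range n, starWeight T j • u j - ∑ j ∈ range i, starWeight T j • u j

lemma tailSum_succ (T : ℝ) (n : ℕ) (u : ℕ → E) (i : ℕ) :
    tailSum T n u i = starWeight T i • u i + tailSum T n u (i + 1) := by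
  simp only [tailSum, sum_range_succ _ i]; abel

/-- Exchanging the double sum pairs each variable with later ones only, as elimination in increasing
order requires. -/
lemma gradForm_eq_sum_tailSum (T : ℝ) (n : ℕ) (u : ℕ → E) :
    gradForm T n u = ∑ i ∈ range n, (2 * chainWeight T (i + 1) * ‖u i‖ ^ 2 +
      2 * inner ℝ (u i) (tailSum T n u (i + 1))) := by
  have key : ∀ k, gradForm T k u + 2 * inner ℝ (∑ j ∈ range k, u j) (tailSum T n u k) =
      ∑ i ∈ range k, (2 * chainWeight T (i + 1) * ‖u i‖ ^ 2 +
        2 * inner ℝ (u i) (tailSum T n u (i + 1))) := by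
    intro k
    induction k with
    | zero => simp [gradForm]
    | succ k ih =>
      simp only [gradForm, sum_range_succ _ k, tailSum_succ T n u k, inner_add_left,
        inner_add_right, inner_smul_right] at ih ⊢
      rw [real_inner_comm (u k) (∑ j ∈ range k, u j)] at ih
      linear_combination ih
  have := key n
  simpa [tailSum] using this

/-- The variables that diagonalize `gradForm` minus a multiple of the squared weighted sum. -/
noncomputable def elimVar (T : ℝ) (n : ℕ) (u : ℕ → E) (i : ℕ) : E :=
  u i + ((1 - corrCoeff T i * starWeight T i) / pivot T i) • tailSum T n u (i + 1)

lemma elimination_step (T : ℝ) (n : ℕ) (u : ℕ → E) {i : ℕ} (hi : 2 * (i : ℝ) + 2 < T) :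
    2 * chainWeight T (i + 1) * ‖u i‖ ^ 2 + 2 * inner ℝ (u i) (tailSum T n u (i + 1)) =
      pivot T i * ‖elimVar T n u i‖ ^ 2 + (corrCoeff T i * ‖tailSum T n u i‖ ^ 2 -
        corrCoeff T (i + 1) * ‖tailSum T n u (i + 1)‖ ^ 2) := by
  rw [tailSum_succ T n u i, elimVar]
  have hd := (pivot_pos hi).ne'
  have h1 := pivot_eq hi
  have h2 := corrCoeff_succ_sub hi
  generalize tailSum T n u (i + 1) = w
  simp only [norm_add_sq_real, norm_smul, mul_pow, inner_smul_left, inner_smul_right,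
    Real.norm_eq_abs, sq_abs, conj_trivial, div_pow]
  have h3 : pivot T i * ((1 - corrCoeff T i * starWeight T i) ^ 2 / pivot T i ^ 2) =
      corrCoeff T (i + 1) - corrCoeff T i := by
    rw [← h2]; field_simp
  have h4 : pivot T i * ((1 - corrCoeff T i * starWeight T i) / pivot T i) =
      1 - corrCoeff T i * starWeight T i := by field_simp
  linear_combination ‖u i‖ ^ 2 * h1 - ‖w‖ ^ 2 * h3 - 2 * inner ℝ (u i) w * h4

lemma tailSum_step (T : ℝ) (n : ℕ) (u : ℕ → E) {i : ℕ} (hi : 2 * (i : ℝ) + 2 < T) :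
    ((T - i) / (T - 2 * i)) • tailSum T n u i =
      ((T - i) / (T - 2 * i) * starWeight T i) • elimVar T n u i +
        ((T - (i + 1 : ℕ)) / (T - 2 * (i + 1 : ℕ))) • tailSum T n u (i + 1) := by
  have h0 : (0 : ℝ) ≤ i := i.cast_nonneg
  have h1 : T - i ≠ 0 := by linarith
  have h2 : T - i * 2 ≠ 0 := by linarith
  have h2' : T - 2 * i ≠ 0 := by linarith
  have h4 : T - 2 * i - 2 ≠ 0 := by linarith
  have h4' : T - 2 * (i + 1) ≠ 0 := by linarith
  have hd := (pivot_pos hi).ne'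
  have h := one_sub_starWeight_mul hi
  rw [tailSum_succ T n u i, elimVar, smul_add, smul_add, smul_smul, smul_smul, add_assoc,
    ← add_smul]
  congr 2
  set r := 1 - corrCoeff T i * starWeight T i
  have h5 : 1 - starWeight T i * (r / pivot T i) =
      (T - 2 * i) * (T - i - 1) / ((T - 2 * i - 2) * (T - i)) := by
    rw [eq_comm, ← mul_left_inj' hd, ← h]; field_simp
  have h6 : (T - i) / (T - 2 * i) * ((T - 2 * i) * (T - i - 1) / ((T - 2 * i - 2) * (T - i))) =
      (T - (i + 1 : ℕ)) / (T - 2 * (i + 1 : ℕ)) := by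
    push_cast
    have h7 : T - 2 * i - 2 = T - 2 * (i + 1) := by ring
    rw [h7]
    field_simp
    ring
  rw [← h6, ← h5]
  ring

/-- The rank one corrections telescope, from `corrCoeff T 0 = T` on the full sum to the empty tail.
-/
lemma gradForm_sub_eq {T : ℝ} {n : ℕ} (hn : 2 * (n : ℝ) < T) (u : ℕ → E) :
    gradForm T n u - T * ‖∑ i ∈ range n, starWeight T i • u i‖ ^ 2 =
      ∑ i ∈ range n, pivot T i * ‖elimVar T n u i‖ ^ 2 := by
  have hT : T ≠ 0 := by have : (0 : ℝ) ≤ n := n.cast_nonneg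
                        linarith
  have hi' : ∀ i ∈ range n, 2 * (i : ℝ) + 2 < T := by
    intro i hi
    have : (i : ℝ) + 1 ≤ n := by exact_mod_cast mem_range.1 hi
    linarith
  rw [gradForm_eq_sum_tailSum, sum_congr rfl fun i hi => elimination_step T n u (hi' i hi),
    sum_add_distrib,
    sum_range_sub' (fun i => corrCoeff T i * ‖tailSum T n u i‖ ^ 2)]
  simp [tailSum, corrCoeff]
  field_simp
  ring

lemma sum_starWeight_smul_eq {T : ℝ} {n : ℕ} (hn : 2 * (n : ℝ) < T) (u : ℕ → E) :
    ∑ i ∈ range n, starWeight T i • u i =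
      ∑ i ∈ range n, ((T - i) / (T - 2 * i) * starWeight T i) • elimVar T n u i := by
  have hT : T ≠ 0 := by have : (0 : ℝ) ≤ n := n.cast_nonneg
                        linarith
  have h : ∀ i ∈ range n, ((T - i) / (T - 2 * i) * starWeight T i) • elimVar T n u i =
      ((T - i) / (T - 2 * i)) • tailSum T n u i -
        ((T - (i + 1 : ℕ)) / (T - 2 * (i + 1 : ℕ))) • tailSum T n u (i + 1) := by
    intro i hi
    have : (i : ℝ) + 1 ≤ n := by exact_mod_cast mem_range.1 hi
    rw [eq_sub_iff_add_eq]
    exact (tailSum_step T n u (by linarith)).symm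
  rw [sum_congr rfl h,
    sum_range_sub' (fun i : ℕ => ((T - i) / (T - 2 * i)) • tailSum T n u i) n]
  simp [tailSum, hT]

lemma norm_sq_le_mul_gradForm_sub {T : ℝ} {n : ℕ} (hn : 2 * (n : ℝ) < T) (u : ℕ → E) :
    ‖∑ i ∈ range n, starWeight T i • u i‖ ^ 2 ≤
      (∑ i ∈ range n, 1 / ((2 * i + 1) * T - 2 * i * (i + 1)) + (1 / (T - 2 * n) - 1 / T)) *
        (gradForm T n u - T * ‖∑ i ∈ range n, starWeight T i • u i‖ ^ 2) := by
  have hi' : ∀ i ∈ range n, 2 * (i : ℝ) + 2 < T := by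
    intro i hi
    have : (i : ℝ) + 1 ≤ n := by exact_mod_cast mem_range.1 hi
    linarith
  have h1 : ∑ i ∈ range n, ((T - i) / (T - 2 * i) * starWeight T i) ^ 2 / pivot T i =
      ∑ i ∈ range n, 1 / ((2 * i + 1) * T - 2 * i * (i + 1)) + (1 / (T - 2 * n) - 1 / T) := by
    rw [sum_congr rfl fun i hi => starWeight_sq_div_pivot (hi' i hi), sum_add_distrib]
    congr 1
    have := sum_range_sub (fun i : ℕ => 1 / (T - 2 * (i : ℝ))) n
    simpa using this
  rw [gradForm_sub_eq hn, ← h1, sum_starWeight_smul_eq hn]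
  refine le_trans (pow_le_pow_left₀ (norm_nonneg _) (norm_sum_le _ _) 2) ?_
  refine sum_sq_le_sum_mul_sum_of_sq_le_mul _ (fun i hi => ?_) (fun i hi => ?_) fun i hi => ?_
  · have := pivot_pos (hi' i hi)
    positivity
  · have := pivot_pos (hi' i hi)
    positivity
  · have := (pivot_pos (hi' i hi)).ne'
    rw [norm_smul, mul_pow, Real.norm_eq_abs, sq_abs]
    field_simp
    rfl

/-- Isolates the dependence on G, so that with T = 2Nc+1 all terms in G cancel in
`mul_norm_sq_le_gradForm`. -/
lemma gradForm_translate {T : ℝ} {n : ℕ} (hn : 2 * (n : ℝ) < T) (u : ℕ → E) (G : E) :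
    gradForm T n (fun i => u i + G) +
        2 * (1 - chainWeight T n) * inner ℝ G (∑ j ∈ range n, (u j + G)) =
      gradForm T n u + 2 * T * inner ℝ (∑ i ∈ range n, starWeight T i • u i) G +
        2 * n * ‖G‖ ^ 2 := by
  induction n with
  | zero => simp [gradForm]
  | succ n ih =>
    push_cast at hn
    have h := chainWeight_succ_add (T := T) (i := n) (by linarith)
    have ih := ih (by linarith)
    have hs : ∑ j ∈ range n, (u j + G) = ∑ j ∈ range n, u j + (n : ℝ) • G := by
      rw [sum_add_distrib, sum_const, card_range, Nat.cast_smul_eq_nsmul]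
    simp only [gradForm, sum_range_succ _ n] at ih ⊢
    rw [hs] at ih ⊢
    generalize ∑ j ∈ range n, u j = S at *
    simp only [norm_add_sq_real, inner_add_left, inner_add_right, inner_smul_left,
      inner_smul_right, conj_trivial, real_inner_self_eq_norm_sq] at ih ⊢
    rw [real_inner_comm (u n) G]
    push_cast
    have hstar : chainWeight T (n + 1) = starWeight T n + chainWeight T n := by
      unfold starWeight; ring
    rw [hstar] at h ⊢
    linear_combination ih + 2 * inner ℝ (u n) G * h

lemma mul_sum_le_one_of_psi_nonneg {N : ℕ} {c : ℝ} (hc : 1 ≤ c) (hψ : 0 ≤ psi N c) :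
    (c - 1) * (2 * N * c + 1) * (∑ i ∈ range N,
      1 / ((2 * i + 1) * (2 * N * c + 1) - 2 * i * (i + 1)) +
        (1 / (2 * N * c + 1 - 2 * N) - 1 / (2 * N * c + 1))) ≤ 1 := by
  have hN : (0 : ℝ) ≤ N := N.cast_nonneg
  have h1 : 0 < 2 * N * c + 1 - 2 * N := by nlinarith
  have h2 : 0 < 2 * N * c + 1 := by linarith
  have h3 : psi N c = 1 - (c - 1) * (2 * N * c + 1) * (2 * N * c + 1 - 2 * N) *
      ∑ i ∈ range N, 1 / ((2 * i + 1) * (2 * N * c + 1) - 2 * (i : ℝ) * (i + 1)) := by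
    rw [psi, mul_sum]
    congr 1
    refine sum_congr rfl fun i _ => ?_
    rw [psiNum, psiDenom, mul_one_div]
    congr 1 <;> ring
  rw [h3] at hψ
  set S := ∑ i ∈ range N, 1 / ((2 * i + 1) * (2 * N * c + 1) - 2 * (i : ℝ) * (i + 1))
  have h4 : (c - 1) * (2 * N * c + 1) * (S + (1 / (2 * N * c + 1 - 2 * N) - 1 / (2 * N * c + 1))) =
      1 - (1 - (c - 1) * (2 * N * c + 1) * (2 * N * c + 1 - 2 * N) * S) /
        (2 * N * c + 1 - 2 * N) := by
    obtain ⟨A, hA⟩ : ∃ A, A = 2 * N * c + 1 - 2 * N := ⟨_, rfl⟩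
    obtain ⟨B, hB⟩ : ∃ B, B = 2 * N * c + 1 := ⟨_, rfl⟩
    rw [← hA] at h1 ⊢
    rw [← hB] at h2 hA ⊢
    field_simp
    rw [hA, hB]
    ring
  rw [h4]
  have := div_nonneg hψ h1.le
  linarith

/-- The quadratic form that certifies the rate for `h = 1` is nonnegative. -/
lemma mul_norm_sq_le_gradForm {N : ℕ} {c : ℝ} (hc : 1 ≤ c) (hψ : 0 ≤ psi N c)
    {T : ℝ} (hT : T = 2 * N * c + 1) (g : ℕ → E) (G : E) :
    T * ‖c • ∑ i ∈ range N, starWeight T i • g i + (1 - c * chainWeight T N) • G‖ ^ 2 ≤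
      c * gradForm T N g + ‖G‖ ^ 2 +
        2 * c * (1 - chainWeight T N) * inner ℝ G (∑ j ∈ range N, g j) := by
  have hN : (0 : ℝ) ≤ N := N.cast_nonneg
  have hNT : 2 * (N : ℝ) < T := by nlinarith
  obtain ⟨u, rfl⟩ : ∃ u : ℕ → E, g = fun i => u i + G := ⟨fun i => g i - G, by simp⟩
  have h1 := gradForm_translate hNT u G
  have h2 : c • ∑ i ∈ range N, starWeight T i • (u i + G) + (1 - c * chainWeight T N) • G =
      c • ∑ i ∈ range N, starWeight T i • u i + G := by
    have : ∑ i ∈ range N, starWeight T i = chainWeight T N := by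
      have := sum_range_sub (chainWeight T) N
      simpa [chainWeight, starWeight] using this
    simp only [smul_add, sum_add_distrib, ← sum_smul, this]
    rw [sub_smul, one_smul, smul_smul]
    abel
  rw [h2, norm_add_sq_real, norm_smul, Real.norm_eq_abs, mul_pow, sq_abs, inner_smul_left,
    conj_trivial]
  have h3 := norm_sq_le_mul_gradForm_sub hNT u
  have h4 := mul_sum_le_one_of_psi_nonneg hc hψ
  rw [← hT] at h4
  have h5 : 0 ≤ gradForm T N u - T * ‖∑ i ∈ range N, starWeight T i • u i‖ ^ 2 := by
    rw [gradForm_sub_eq hNT]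
    refine sum_nonneg fun i hi => mul_nonneg (pivot_pos ?_).le (sq_nonneg _)
    have : (i : ℝ) + 1 ≤ N := by exact_mod_cast mem_range.1 hi
    linarith
  set w := ∑ i ∈ range N, starWeight T i • u i
  set K := ∑ i ∈ range N, 1 / ((2 * i + 1) * T - 2 * (i : ℝ) * (i + 1)) +
    (1 / (T - 2 * N) - 1 / T)
  have h6 : (c - 1) * T * ‖w‖ ^ 2 ≤ gradForm T N u - T * ‖w‖ ^ 2 := by
    calc (c - 1) * T * ‖w‖ ^ 2 ≤ (c - 1) * T * (K * (gradForm T N u - T * ‖w‖ ^ 2)) :=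
          mul_le_mul_of_nonneg_left h3 (mul_nonneg (by linarith) (by linarith))
      _ = (c - 1) * T * K * (gradForm T N u - T * ‖w‖ ^ 2) := by ring
      _ ≤ 1 * (gradForm T N u - T * ‖w‖ ^ 2) := mul_le_mul_of_nonneg_right h4 h5
      _ = _ := one_mul _
  have h7 : c * (T * c * ‖w‖ ^ 2) ≤ c * gradForm T N u :=
    mul_le_mul_of_nonneg_left (by linarith) (by linarith)
  have h8 : T * ‖G‖ ^ 2 = (2 * N * c + 1) * ‖G‖ ^ 2 := by rw [hT]
  linear_combination h7 - c * h1 + h8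

/-- Jensen's inequality for the squared norm, from nonnegativity of the variance. -/
lemma norm_sq_le_of_weights {n : ℕ} {a : ℕ → ℝ} {b : ℝ} (ha : ∀ i ∈ range n, 0 ≤ a i)
    (hb : 0 ≤ b) (hab : ∑ i ∈ range n, a i + b = 1) (g : ℕ → E) (G : E) :
    ‖∑ i ∈ range n, a i • g i + b • G‖ ^ 2 ≤ ∑ i ∈ range n, a i * ‖g i‖ ^ 2 + b * ‖G‖ ^ 2 := by
  set W := ∑ i ∈ range n, a i • g i + b • G with hW
  have h1 : 0 ≤ ∑ i ∈ range n, a i * ‖g i - W‖ ^ 2 + b * ‖G - W‖ ^ 2 :=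
    add_nonneg (sum_nonneg fun i hi => mul_nonneg (ha i hi) (sq_nonneg _))
      (mul_nonneg hb (sq_nonneg _))
  have h2 : ∑ i ∈ range n, a i * ‖g i - W‖ ^ 2 = ∑ i ∈ range n, a i * ‖g i‖ ^ 2 -
      2 * inner ℝ (∑ i ∈ range n, a i • g i) W + (∑ i ∈ range n, a i) * ‖W‖ ^ 2 := by
    rw [sum_inner, mul_sum, sum_mul, ← sum_sub_distrib, ← sum_add_distrib]
    refine sum_congr rfl fun i _ => ?_
    rw [norm_sub_sq_real, inner_smul_left, conj_trivial]
    ring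
  have h3 : inner ℝ (∑ i ∈ range n, a i • g i) W + b * inner ℝ G W = ‖W‖ ^ 2 := by
    rw [← real_inner_self_eq_norm_sq W]
    nth_rw 3 [hW]
    rw [inner_add_left, inner_smul_left, conj_trivial]
  rw [h2, norm_sub_sq_real] at h1
  linear_combination h1 - 2 * h3 + ‖W‖ ^ 2 * hab

end Form

/-! ### Summing the interpolation inequalities -/

section Rate
variable {E : Type*} [NormedAddCommGroup E] [InnerProductSpace ℝ E]

open Finset

/-- Each step adds λ_{n+1} times a chain inequality and t_n times a star inequality; since λ_{n+1} =
λ_n + t_n, the value φ n cancels. Only h of each ½‖g i - g (i+1)‖² is kept. -/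
lemma chain_sum_le {T h φs : ℝ} {n : ℕ} (hn : 2 * (n : ℝ) < T) (hh1 : h ≤ 1)
    {φ : ℕ → ℝ} {g : ℕ → E} {v : E}
    (hchain : ∀ i < n, φ (i + 1) + inner ℝ (g (i + 1)) (h • g i) +
      1 / 2 * ‖g i - g (i + 1)‖ ^ 2 ≤ φ i)
    (hstar : ∀ i < n, φ i + inner ℝ (g i) (h • ∑ j ∈ range i, g j - v) +
      1 / 2 * ‖g i‖ ^ 2 ≤ φs) :
    h * gradForm T n g - 2 * inner ℝ (∑ i ∈ range n, starWeight T i • g i) v +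
        (1 - h) * ∑ i ∈ range n, starWeight T i * ‖g i‖ ^ 2 +
        h * chainWeight T n * ‖g n‖ ^ 2 ≤ 2 * chainWeight T n * (φs - φ n) := by
  induction n with
  | zero => simp [gradForm, chainWeight]
  | succ n ih =>
    push_cast at hn
    replace ih := ih (by linarith) (fun i hi => hchain i (hi.trans n.lt_succ_self))
      (fun i hi => hstar i (hi.trans n.lt_succ_self))
    have h1 := hchain n n.lt_succ_self
    have h2 := hstar n n.lt_succ_self
    have ht : 0 ≤ starWeight T n := starWeight_nonneg (by linarith)
    have hl : 0 ≤ chainWeight T (n + 1) := chainWeight_nonneg (by push_cast; linarith)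
    have h3 : 0 ≤ (1 - h) * ‖g n - g (n + 1)‖ ^ 2 := mul_nonneg (by linarith) (sq_nonneg _)
    simp only [gradForm, sum_range_succ _ n, inner_add_left, inner_sub_right, inner_smul_right,
      inner_smul_left, conj_trivial, norm_sub_sq_real] at *
    rw [real_inner_comm (g n) (g (n + 1))] at h1
    have hstep : chainWeight T (n + 1) = starWeight T n + chainWeight T n := by
      unfold starWeight; ring
    have h4 : 0 ≤ chainWeight T (n + 1) * (2 * φ n - 2 * φ (n + 1) -
        h * (‖g n‖ ^ 2 + ‖g (n + 1)‖ ^ 2)) := mul_nonneg hl (by linarith)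
    have h5 := mul_nonneg ht (sub_nonneg.2 h2)
    rw [hstep] at h4 ⊢
    linear_combination ih + h4 + 2 * h5

/-- The performance estimate from the interpolation inequalities along gradient descent and at the
extrapolated point. -/
lemma sub_le_of_interpolation {n : ℕ} {c h φσ φs : ℝ} (hc : 1 ≤ c) (hψ : 0 ≤ psi (n + 1) c)
    (hh0 : 0 < h) (hh1 : h ≤ 1) {φ : ℕ → ℝ} {g : ℕ → E} {G v : E}
    (hchain : ∀ i < n, φ (i + 1) + inner ℝ (g (i + 1)) (h • g i) +
      1 / 2 * ‖g i - g (i + 1)‖ ^ 2 ≤ φ i)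
    (hlast : φσ + inner ℝ G ((h * c) • ∑ j ∈ range (n + 1), g j - h • ∑ j ∈ range n, g j) +
      1 / 2 * ‖g n - G‖ ^ 2 ≤ φ n)
    (hstar : ∀ i < n + 1, φ i + inner ℝ (g i) (h • ∑ j ∈ range i, g j - v) +
      1 / 2 * ‖g i‖ ^ 2 ≤ φs)
    (hstar' : φσ + inner ℝ G ((h * c) • ∑ j ∈ range (n + 1), g j - v) + 1 / 2 * ‖G‖ ^ 2 ≤ φs) :
    φσ - φs ≤ ‖v‖ ^ 2 / (4 * (n + 1) * h * c + 2) := by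
  have hn0 : (0 : ℝ) ≤ n := n.cast_nonneg
  obtain ⟨T, hT⟩ : ∃ T : ℝ, T = 2 * (n + 1 : ℕ) * c + 1 := ⟨_, rfl⟩
  have hT' : T = 2 * (n + 1) * c + 1 := by rw [hT]; push_cast; ring
  have hnT : 2 * (n : ℝ) + 2 < T := by nlinarith
  have hA := chain_sum_le (T := T) (by linarith) hh1 hchain
    (fun i hi => hstar i (hi.trans n.lt_succ_self))
  have ht : 0 ≤ starWeight T n := starWeight_nonneg hnT
  have hl : 0 ≤ chainWeight T (n + 1) := chainWeight_nonneg (by push_cast; linarith)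
  have hl1 : c * chainWeight T (n + 1) ≤ 1 := by
    unfold chainWeight
    push_cast
    rw [← mul_div_assoc, div_le_one (by linarith), hT']
    nlinarith
  have hstep : chainWeight T (n + 1) = starWeight T n + chainWeight T n := by
    unfold starWeight; ring
  -- the sum of all inequalities, as a form that is affine in `h`
  have hsum : h * (c * gradForm T (n + 1) g + ‖G‖ ^ 2 +
        2 * c * (1 - chainWeight T (n + 1)) * inner ℝ G (∑ j ∈ range (n + 1), g j)) +
      (1 - h) * (∑ i ∈ range (n + 1), c * starWeight T i * ‖g i‖ ^ 2 +
        (1 - c * chainWeight T (n + 1)) * ‖G‖ ^ 2) -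
      2 * inner ℝ (c • ∑ i ∈ range (n + 1), starWeight T i • g i +
        (1 - c * chainWeight T (n + 1)) • G) v ≤ 2 * (φs - φσ) := by
    have h2 := hstar n n.lt_succ_self
    have h3 : 0 ≤ (1 - h) * ‖g n - G‖ ^ 2 := mul_nonneg (by linarith) (sq_nonneg _)
    have h6 : ∑ i ∈ range (n + 1), c * starWeight T i * ‖g i‖ ^ 2 =
        c * ∑ i ∈ range (n + 1), starWeight T i * ‖g i‖ ^ 2 := by
      rw [mul_sum]; exact sum_congr rfl fun _ _ => mul_assoc _ _ _
    rw [h6]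
    simp only [gradForm, sum_range_succ _ n, inner_add_left, inner_add_right, inner_sub_right,
      inner_smul_right, inner_smul_left, conj_trivial, norm_sub_sq_real] at *
    rw [real_inner_comm G (g n)] at hlast h3
    -- The displacement from x_{N-1} to x_σ is a gradient step plus (c-1) times the whole path,
    -- hence the extra cross term.
    have h4 : 0 ≤ c * chainWeight T (n + 1) * (2 * φ n - 2 * φσ - h * (‖g n‖ ^ 2 + ‖G‖ ^ 2) -
        2 * h * (c - 1) * (inner ℝ G (∑ j ∈ range n, g j) + inner ℝ G (g n))) :=
      mul_nonneg (mul_nonneg (by linarith) hl) (by linarith)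
    have h5 := mul_nonneg (mul_nonneg (by linarith : 0 ≤ c) ht) (sub_nonneg.2 h2)
    have h7 := mul_nonneg (sub_nonneg.2 hl1) (sub_nonneg.2 hstar')
    rw [hstep] at h4 h7 ⊢
    linear_combination c * hA + h4 + 2 * h5 + 2 * h7
  have hB := mul_norm_sq_le_gradForm hc hψ hT g G
  have hC := norm_sq_le_of_weights (n := n + 1) (a := fun i => c * starWeight T i)
    (b := 1 - c * chainWeight T (n + 1))
    (fun i hi => mul_nonneg (by linarith) (starWeight_nonneg (by
      have : (i : ℝ) + 1 ≤ (n + 1 : ℕ) := by exact_mod_cast mem_range.1 hi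
      push_cast at this; linarith))) (by linarith) (by
      have := sum_range_sub (chainWeight T) (n + 1)
      rw [← mul_sum]
      simp only [starWeight, this]
      simp [chainWeight]) g G
  have hW : ∑ i ∈ range (n + 1), (c * starWeight T i) • g i =
      c • ∑ i ∈ range (n + 1), starWeight T i • g i := by
    rw [smul_sum]; exact sum_congr rfl fun _ _ => mul_smul _ _ _
  rw [hW] at hC
  set W := c • ∑ i ∈ range (n + 1), starWeight T i • g i + (1 - c * chainWeight T (n + 1)) • G
  have hq : 0 < 2 * (n + 1) * h * c + 1 := by positivity
  have hD := mul_le_mul_of_nonneg_left hB hh0.le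
  have hE := mul_le_mul_of_nonneg_left hC (sub_nonneg.2 hh1)
  have hF : (2 * (n + 1) * h * c + 1) * ‖W‖ ^ 2 - 2 * inner ℝ W v ≤ 2 * (φs - φσ) := by
    have : h * (T * ‖W‖ ^ 2) = (2 * (n + 1) * h * c + h) * ‖W‖ ^ 2 := by rw [hT']; ring
    linarith
  -- Completing the square in W.
  have hG : 0 ≤ ‖(2 * (n + 1) * h * c + 1) • W - v‖ ^ 2 := sq_nonneg _
  rw [norm_sub_sq_real, norm_smul, Real.norm_of_nonneg hq.le, inner_smul_left, conj_trivial] at hG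
  rw [le_div_iff₀ (by linarith)]
  have hH := mul_le_mul_of_nonneg_left hF hq.le
  nlinarith

end Rate

/-! ### Application to gradient descent, with f and its gradient divided by L -/

section GradientDescent
variable {m : ℕ} {f : EuclideanSpace ℝ (Fin m) → ℝ}

lemma gdIterate_eq (f : EuclideanSpace ℝ (Fin m) → ℝ) {L : ℝ} (h : ℝ)
    (x₀ : EuclideanSpace ℝ (Fin m)) (k : ℕ) :
    gdIterate f L h x₀ k =
      x₀ - h • ∑ j ∈ Finset.range k, (1 / L) • ∇ f (gdIterate f L h x₀ j) := by
  induction k with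
  | zero => simp [gdIterate]
  | succ k ih =>
    rw [gdIterate, Finset.sum_range_succ, smul_add, ← sub_sub, ← ih, smul_smul, mul_one_div]

lemma simpleExtrapolation_sub_le {N : ℕ} (hN : 0 < N) {L h c : ℝ} (hL : 0 < L) (hh0 : 0 < h)
    (hh1 : h ≤ 1) (hc : 1 ≤ c) (hψ : 0 ≤ psi N c) {x₀ x_star : EuclideanSpace ℝ (Fin m)}
    (hconv : ConvexOn ℝ Set.univ f) (hf : IsLSmooth L f) (hmin : ∀ y, f x_star ≤ f y) :
    f (simpleExtrapolation f L h x₀ N c) - f x_star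
      ≤ L * ‖x₀ - x_star‖ ^ 2 / (4 * N * h * c + 2) := by
  obtain ⟨n, rfl⟩ : ∃ n, N = n + 1 := ⟨N - 1, by omega⟩
  have hx := gdIterate_eq f (L := L) h x₀
  have hσ : simpleExtrapolation f L h x₀ (n + 1) c = x₀ - (h * c) •
      ∑ j ∈ Finset.range (n + 1), (1 / L) • ∇ f (gdIterate f L h x₀ j) := by
    rw [simpleExtrapolation, hx, sub_sub_cancel_left, smul_neg, smul_smul, mul_comm c h,
      sub_eq_add_neg]
  set x := gdIterate f L h x₀
  set xσ := simpleExtrapolation f L h x₀ (n + 1) c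
  have key : ∀ y z d, z - y = d →
      f y / L + inner ℝ ((1 / L) • ∇ f y) d +
        1 / 2 * ‖(1 / L) • ∇ f z - (1 / L) • ∇ f y‖ ^ 2 ≤ f z / L := by
    rintro y z d rfl
    have h1 := hconv.add_inner_gradient_add_le hL hf z y
    have h2 := div_le_div_of_nonneg_right h1 hL.le
    rw [← smul_sub, norm_smul, inner_smul_left, conj_trivial, Real.norm_of_nonneg (by positivity)]
    refine le_trans (le_of_eq ?_) h2
    field_simp
  have hgs : ∇ f x_star = 0 := gradient_eq_zero_of_forall_le hmin
  have key' : ∀ y d, x_star - y = d →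
      f y / L + inner ℝ ((1 / L) • ∇ f y) d + 1 / 2 * ‖(1 / L) • ∇ f y‖ ^ 2 ≤ f x_star / L := by
    intro y d hd
    simpa [hgs] using key y x_star d hd
  have := sub_le_of_interpolation (φ := fun i => f (x i) / L)
    (g := fun i => (1 / L) • ∇ f (x i)) (φσ := f xσ / L) (φs := f x_star / L)
    (G := (1 / L) • ∇ f xσ) (v := x₀ - x_star) hc hψ hh0 hh1
    (fun i _ => key _ _ _ (by
      rw [hx (i + 1), Finset.sum_range_succ, smul_add, ← sub_sub, ← hx i, sub_sub_cancel]))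
    (key _ _ _ (by rw [hσ, hx n]; abel))
    (fun i _ => key' _ _ (by rw [hx i]; abel))
    (key' _ _ (by rw [hσ]; abel))
  rw [← sub_div, div_le_iff₀ hL] at this
  push_cast
  rw [mul_div_assoc, mul_comm]
  exact this

end GradientDescent

/-! ### Huber functions and tightness -/

section Huber

/-- The derivative of the Huber function. -/
noncomputable def huberDeriv (L η x : ℝ) : ℝ := L * max (-η) (min η x)

variable {L η : ℝ}

lemma huber_of_abs_le {x : ℝ} (hx : |x| ≤ η) : huber L η x = L / 2 * x ^ 2 := if_pos hx

lemma huber_of_le {x : ℝ} (hη : 0 ≤ η) (hx : η ≤ x) :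
    huber L η x = L * η * x - L * η ^ 2 / 2 := by
  have h0 : |x| = x := abs_of_nonneg (hη.trans hx)
  rcases hx.eq_or_lt with rfl | hx
  · rw [huber_of_abs_le h0.le]; ring
  · rw [huber, if_neg (by rw [h0]; exact not_le.2 hx), h0]

lemma huber_neg (x : ℝ) : huber L η (-x) = huber L η x := by simp [huber]

lemma huber_of_le_neg {x : ℝ} (hη : 0 ≤ η) (hx : x ≤ -η) :
    huber L η x = -(L * η * x) - L * η ^ 2 / 2 := by
  rw [← huber_neg, huber_of_le hη (by linarith)]; ring

lemma huberDeriv_cases (hη : 0 ≤ η) (x : ℝ) :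
    (x ≤ -η ∧ huber L η x = L * (-(η * x) - η ^ 2 / 2) ∧ huberDeriv L η x = L * (-η)) ∨
    (-η ≤ x ∧ x ≤ η ∧ huber L η x = L * (x ^ 2 / 2) ∧ huberDeriv L η x = L * x) ∨
    (η ≤ x ∧ huber L η x = L * (η * x - η ^ 2 / 2) ∧ huberDeriv L η x = L * η) := by
  rcases le_total x (-η) with h | h
  · left
    refine ⟨h, by rw [huber_of_le_neg hη h]; ring, ?_⟩
    rw [huberDeriv, min_eq_right (by linarith), max_eq_left h]
  · rcases le_total x η with h' | h'
    · right; left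
      refine ⟨h, h', by rw [huber_of_abs_le (abs_le.2 ⟨h, h'⟩)]; ring, ?_⟩
      rw [huberDeriv, min_eq_right h', max_eq_right h]
    · right; right
      refine ⟨h', by rw [huber_of_le hη h']; ring, ?_⟩
      rw [huberDeriv, min_eq_left h', max_eq_right (by linarith)]

/-- One two-sided Taylor bound serves twice: the lower half gives convexity, and both halves give
the gradient, kinks of the derivative included. -/
lemma huber_sub_bounds (hL : 0 ≤ L) (hη : 0 ≤ η) (x y : ℝ) :
    0 ≤ huber L η y - huber L η x - huberDeriv L η x * (y - x) ∧
      huber L η y - huber L η x - huberDeriv L η x * (y - x) ≤ L / 2 * (y - x) ^ 2 := by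
  suffices h : ∃ r, huber L η y - huber L η x - huberDeriv L η x * (y - x) = L * r ∧ 0 ≤ r ∧
      r ≤ (y - x) ^ 2 / 2 by
    obtain ⟨r, h1, h2, h3⟩ := h
    rw [h1]
    exact ⟨mul_nonneg hL h2, by nlinarith⟩
  rcases huberDeriv_cases (L := L) hη x with ⟨a, b, d⟩ | ⟨a, a', b, d⟩ | ⟨a, b, d⟩ <;>
  rcases huberDeriv_cases (L := L) hη y with ⟨p, q, _⟩ | ⟨p, p', q, _⟩ | ⟨p, q, _⟩ <;>
  rw [b, d, q, mul_assoc, ← mul_sub, ← mul_sub] <;>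
  refine ⟨_, rfl, ?_, ?_⟩ <;>
  nlinarith [sq_nonneg (y - x), sq_nonneg (y - η), sq_nonneg (y + η), sq_nonneg (x - η),
    sq_nonneg (x + η)]

lemma abs_huberDeriv_sub_le (hL : 0 ≤ L) (x y : ℝ) :
    |huberDeriv L η x - huberDeriv L η y| ≤ L * |x - y| := by
  rw [huberDeriv, huberDeriv, ← mul_sub, abs_mul, abs_of_nonneg hL]
  refine mul_le_mul_of_nonneg_left ?_ hL
  refine (abs_max_sub_max_le_max _ _ _ _).trans (max_le (by simp) ?_)
  exact (abs_min_sub_min_le_max _ _ _ _).trans (max_le (by simp) le_rfl)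

lemma EuclideanSpace.norm_fin_one (x : EuclideanSpace ℝ (Fin 1)) : ‖x‖ = |x 0| := by
  simp [EuclideanSpace.norm_eq, Real.sqrt_sq_eq_abs]

lemma hasGradientAt_huber (hL : 0 ≤ L) (hη : 0 ≤ η) (x : EuclideanSpace ℝ (Fin 1)) :
    HasGradientAt (fun y : EuclideanSpace ℝ (Fin 1) => huber L η (y 0))
      (EuclideanSpace.single 0 (huberDeriv L η (x 0))) x := by
  rw [hasGradientAt_iff_isLittleO]
  refine Asymptotics.IsBigO.trans_isLittleO (g := fun y => ‖y - x‖ ^ 2) ?_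
    (Asymptotics.isLittleO_pow_sub_sub x one_lt_two)
  refine Asymptotics.IsBigO.of_bound (L / 2) (Filter.Eventually.of_forall fun y => ?_)
  obtain ⟨h1, h2⟩ := huber_sub_bounds hL hη (x 0) (y 0)
  have h3 : inner ℝ (EuclideanSpace.single 0 (huberDeriv L η (x 0))) (y - x) =
      huberDeriv L η (x 0) * (y 0 - x 0) := by
    simp [EuclideanSpace.inner_single_left]
  rw [h3, Real.norm_of_nonneg h1, Real.norm_of_nonneg (by positivity),
    EuclideanSpace.norm_fin_one, sq_abs]
  exact h2

lemma gradient_huber (hL : 0 ≤ L) (hη : 0 ≤ η) (x : EuclideanSpace ℝ (Fin 1)) :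
    ∇ (fun y : EuclideanSpace ℝ (Fin 1) => huber L η (y 0)) x =
      EuclideanSpace.single 0 (huberDeriv L η (x 0)) :=
  (hasGradientAt_huber hL hη x).gradient

lemma isLSmooth_huber (hL : 0 ≤ L) (hη : 0 ≤ η) :
    IsLSmooth L (fun y : EuclideanSpace ℝ (Fin 1) => huber L η (y 0)) := by
  refine ⟨fun x => (hasGradientAt_huber hL hη x).differentiableAt, fun x y => ?_⟩
  rw [gradient_huber hL hη, gradient_huber hL hη, EuclideanSpace.norm_fin_one,
    EuclideanSpace.norm_fin_one]
  simpa using abs_huberDeriv_sub_le hL (x 0) (y 0)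

lemma convexOn_huber (hL : 0 ≤ L) (hη : 0 ≤ η) :
    ConvexOn ℝ Set.univ (fun y : EuclideanSpace ℝ (Fin 1) => huber L η (y 0)) := by
  refine ⟨convex_univ, fun x _ y _ a b ha hb hab => ?_⟩
  set z := a • x + b • y with hz
  have hz0 : z 0 = a * x 0 + b * y 0 := by simp [hz]
  have h1 := mul_nonneg ha (huber_sub_bounds hL hη (z 0) (x 0)).1
  have h2 := mul_nonneg hb (huber_sub_bounds hL hη (z 0) (y 0)).1
  simp only [smul_eq_mul]
  obtain rfl : b = 1 - a := by linarith
  generalize huberDeriv L η (z 0) = d at *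
  have h3 : d * z 0 = d * (a * x 0 + (1 - a) * y 0) := by rw [hz0]
  linear_combination h1 + h2 + h3

lemma huber_zero (hη : 0 ≤ η) : huber L η 0 = 0 := by
  rw [huber_of_abs_le (by simpa using hη)]; ring

lemma huber_nonneg (hL : 0 ≤ L) (hη : 0 ≤ η) (x : ℝ) : 0 ≤ huber L η x := by
  have h := (huber_sub_bounds hL hη 0 x).1
  have h0 : huberDeriv L η 0 = 0 := by simp [huberDeriv, hη]
  rwa [huber_zero hη, h0, zero_mul, sub_zero, sub_zero] at h

/-- The bound on D keeps the iterates at or above η, where the gradient is constantly Lη. -/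
lemma gdIterate_huber {N : ℕ} {h D : ℝ} (hL : 0 < L) (hη : 0 ≤ η) (hh : 0 ≤ h)
    (hD : (N * h + 1) * η ≤ D) {k : ℕ} (hk : k ≤ N) :
    gdIterate (fun y : EuclideanSpace ℝ (Fin 1) => huber L η (y 0)) L h
      (EuclideanSpace.single 0 D) k 0 = D - k * h * η := by
  induction k with
  | zero => simp [gdIterate]
  | succ k ih =>
    have ih := ih (by omega)
    have hkN : (k : ℝ) ≤ N := by exact_mod_cast (by omega : k ≤ N)
    have h1 : k * h * η ≤ N * h * η := by gcongr
    rw [gdIterate, gradient_huber hL.le hη, PiLp.sub_apply, PiLp.smul_apply, ih, huberDeriv,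
      min_eq_left (by linarith), max_eq_right (by linarith)]
    simp only [PiLp.single_apply, if_true, smul_eq_mul]
    push_cast
    field_simp
    ring

/-- On the linear branch the value at x_σ is Lη(D-Nhcη) - Lη²/2; this η maximizes it, and then x_σ =
(Nhc+1)η ≥ η. -/
lemma huber_simpleExtrapolation {N : ℕ} {h c D : ℝ} (hL : 0 < L) (hh : 0 < h) (hc : 1 ≤ c)
    (hD : 0 < D) (hη : η = D / (2 * N * h * c + 1)) :
    huber L η (simpleExtrapolation (fun y : EuclideanSpace ℝ (Fin 1) => huber L η (y 0)) L h
      (EuclideanSpace.single 0 D) N c 0) = L * D ^ 2 / (4 * N * h * c + 2) := by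
  have hq : 0 < 2 * N * h * c + 1 := by positivity
  have hη0 : 0 < η := by rw [hη]; positivity
  have hD' : D = (2 * N * h * c + 1) * η := by rw [hη]; field_simp
  have h1 : N * h * η ≤ c * (N * h * η) := le_mul_of_one_le_left (by positivity) hc
  have h2 : 0 ≤ N * h * η := by positivity
  have hx := gdIterate_huber (N := N) (D := D) hL hη0.le hh.le
    (by rw [hD']; linarith) le_rfl
  have hσ : simpleExtrapolation (fun y : EuclideanSpace ℝ (Fin 1) => huber L η (y 0)) L h
      (EuclideanSpace.single 0 D) N c 0 = (N * h * c + 1) * η := by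
    rw [simpleExtrapolation, PiLp.add_apply, PiLp.smul_apply, PiLp.sub_apply, hx]
    simp only [PiLp.single_apply, if_true, smul_eq_mul]
    rw [hD']
    ring
  rw [hσ, huber_of_le hη0.le (by linarith), hD', eq_div_iff (by linarith)]
  ring

end Huber

theorem theorem4p1 (N : ℕ) (hN : 0 < N) :
    ∃ c_crit : ℝ, IsGreatest (psiRoots N) c_crit ∧ 1 < c_crit ∧
      ∀ (L : ℝ), 0 < L → ∀ (h : ℝ), 0 < h → h ≤ 1 → ∀ (c : ℝ), c ∈ Set.Icc 1 c_crit →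
        -- the upper bound, in every dimension
        (∀ (m : ℕ) (f : EuclideanSpace ℝ (Fin m) → ℝ) (x₀ x_star : EuclideanSpace ℝ (Fin m)),
          ConvexOn ℝ Set.univ f → IsLSmooth L f → (∀ y, f x_star ≤ f y) →
            f (simpleExtrapolation f L h x₀ N c) - f x_star
              ≤ L * ‖x₀ - x_star‖ ^ 2 / (4 * N * h * c + 2)) ∧
        -- equality is attained by a Huber function on the line
        (∀ (D : ℝ), 0 < D → ∃ (η : ℝ) (f : EuclideanSpace ℝ (Fin 1) → ℝ)
            (x₀ x_star : EuclideanSpace ℝ (Fin 1)),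
          0 < η ∧ (∀ x, f x = huber L η (x 0)) ∧
            ConvexOn ℝ Set.univ f ∧ IsLSmooth L f ∧ (∀ y, f x_star ≤ f y) ∧
            ‖x₀ - x_star‖ = D ∧
            f (simpleExtrapolation f L h x₀ N c) - f x_star
              = L * D ^ 2 / (4 * N * h * c + 2)) := by
  obtain ⟨c₀, hroot, hc₀, hpsi⟩ := exists_isGreatest_psiRoots hN
  refine ⟨c₀, hroot, hc₀, fun L hL h hh0 hh1 c hc => ⟨fun m f x₀ x_star hconv hf hmin =>
    simpleExtrapolation_sub_le hN hL hh0 hh1 hc.1 (hpsi c hc) hconv hf hmin, fun D hD => ?_⟩⟩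
  have hc1 : 1 ≤ c := hc.1
  have hη : 0 < D / (2 * N * h * c + 1) := by positivity
  refine ⟨_, fun y => huber L (D / (2 * N * h * c + 1)) (y 0), EuclideanSpace.single 0 D, 0, hη,
    fun _ => rfl, convexOn_huber hL.le hη.le, isLSmooth_huber hL.le hη.le, fun y => ?_, ?_, ?_⟩
  · simpa [huber_zero hη.le] using huber_nonneg hL.le hη.le (y 0)
  · simp [abs_of_pos hD]
  · simp only [PiLp.zero_apply, huber_zero hη.le, sub_zero]
    exact huber_simpleExtrapolation hL hh0 hc1 hD rfl
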